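/- **Setting.** A *$k$-spike mixture* is a probability distribution $\vartheta$ on $[0,1]$ supported on (at most) $k$ points. A *$K$-snapshot* of $\vartheta$ is obtained by drawing $\alpha\in[0,1]$ from $\vartheta$ and then tossing a coin with heads-probability $\alpha$ independently $K$ times. For probability distributions $P,Q$ on $[0,1]$, $\mathrm{Tran}(P,Q)=\inf_\gamma\int|x-y|\,d\gamma(x,y)$, the infimum being over all couplings $\gamma$ of $P$ and $Q$. **Algorithm.** Let $k\ge 1$, $K=2k-1$, and let $A,c$ be positive integer constants. Given $N$ independent $K$-snapshots, let $\widetilde{\mathsf{fq}}_i$ $(0\le i\le K)$ be the fraction of them with exactly $i$ heads, put $\widetilde{\mathsf{nfq}}_i=\widetilde{\mathsf{fq}}_i/\binom Ki$, and let $$\widetilde g_i=\sum_{j=i}^{K}\binom{K-i}{j-i}\,\widetilde{\mathsf{nfq}}_j \qquad(0\le i\le K)$$ be the empirical moments. Let $\tau=1/m$ with $m=\lceil c\,(k/\varepsilon)^{ck}\rceil$. Guess a set $S\subseteq\{0,1,\dots,m\}$ with $|S|=k$ for which the linear program $$\Bigl|\sum_{j\in S}x_j\,(j\tau)^i-\widetilde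 g_i\Bigr|\le A K\tau\quad(1\le i\le K),\qquad \sum_{j\in S}x_j=1,\qquad x_j\in[0,1]\ \ (j\in S)$$ is feasible, and output $\widetilde\vartheta=\sum_{j\in S}x_j\,\delta_{j\tau}$ for any feasible solution $x$. **Theorem.** There are positive integer constants $A,c,C$ such that the following holds for all integers $k\ge1$, all $\varepsilon\in(0,1]$, all $\delta\in(0,1/2]$, every $k$-spike mixture $\vartheta$ on $[0,1]$, and every integer $$N\ \ge\ C\,(k/\varepsilon)^{Ck}\,\log(1/\delta).$$ Run on $N$ independent $(2k-1)$-snapshots of $\vartheta$, with probability at least $1-\delta$ the linear program is feasible for some guess $S$, and every possible output $\widetilde\vartheta$ of the algorithm (for every guess $S$ with a feasible program and every feasible solution $x$) satisfies $\mathrm{Tran}(\widetilde\vartheta,\vartheta)\le\varepsilon$. -/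

import Mathlib

open MeasureTheory ProbabilityTheory
open scoped unitInterval ENNReal Matrix

/-- The transportation distance between two measures on a metric space: the infimum of
`∫ d(x,y) dγ(x,y)` over all couplings `γ` of `P` and `Q`. -/
noncomputable def transportDist {X : Type*} [MeasurableSpace X] [PseudoEMetricSpace X]
    (P Q : Measure X) : ℝ≥0∞ :=
  ⨅ (γ : Measure (X × X)) (_ : γ.map Prod.fst = P ∧ γ.map Prod.snd = Q),
    ∫⁻ z, edist z.1 z.2 ∂γ

/-- A `k`-spike mixture on `[0,1]`: a probability distribution carried by `k` points
(fewer are allowed, which amounts to spikes of weight zero). -/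
def IsSpikeMixture (k : ℕ) (ϑ : Measure I) : Prop :=
  IsProbabilityMeasure ϑ ∧ ∃ S : Finset I, S.card ≤ k ∧ ϑ ((S : Set I)ᶜ) = 0

/-- The law of `K` independent tosses of a coin of bias `α`; `true` means "heads". -/
noncomputable def tossLaw (K : ℕ) (α : I) : Measure (Fin K → Bool) :=
  Measure.pi fun _ => bernoulliMeasure true false α

instance (K : ℕ) (α : I) : IsProbabilityMeasure (tossLaw K α) := by
  unfold tossLaw; infer_instance

theorem measurable_tossLaw (K : ℕ) : Measurable (tossLaw K) := by
  have hs : ∀ w : Fin K → Bool, Measurable fun α => tossLaw K α {w} := by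
    intro w
    simp only [tossLaw, Measure.pi_singleton]
    refine Finset.measurable_prod _ fun i _ => ?_
    cases h : w i
    · simp only [bernoulliMeasure_def, Measure.add_apply, Measure.smul_apply]
      simp
      fun_prop
    · simp only [bernoulliMeasure_def, Measure.add_apply, Measure.smul_apply]
      simp
      fun_prop
  refine Measure.measurable_of_measurable_coe _ fun s _ => ?_
  have h : (fun α => tossLaw K α s) = fun α => ∑ w ∈ s.toFinite.toFinset, tossLaw K α {w} := by
    funext α
    rw [sum_measure_singleton]
    simp
  rw [h]
  exact Finset.measurable_sum _ fun w _ => hs w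

/-- The law of a `K`-snapshot of the mixture `ϑ`: draw a bias `α` from `ϑ`, then toss the
coin of bias `α` independently `K` times. -/
noncomputable def snapshotLaw (K : ℕ) (ϑ : Measure I) : Measure (Fin K → Bool) :=
  ϑ.bind (tossLaw K)

instance (K : ℕ) (ϑ : Measure I) [IsProbabilityMeasure ϑ] :
    IsProbabilityMeasure (snapshotLaw K ϑ) :=
  isProbabilityMeasure_bind (measurable_tossLaw K).aemeasurable
    (Filter.Eventually.of_forall fun _ => inferInstance)

/-- The number of heads in a snapshot. -/
def heads {K : ℕ} (w : Fin K → Bool) : ℕ :=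
  (Finset.univ.filter fun t => w t = true).card

/-- The empirical frequency vector: its `i`-th entry is the fraction of the `N` sampled coins
that showed heads exactly `i` times. -/
noncomputable def empFreq {K N : ℕ} (ω : Fin N → Fin K → Bool) (i : Fin (K + 1)) : ℝ :=
  ((Finset.univ.filter fun s => heads (ω s) = i.val).card : ℝ) / N

/-- The empirical normalized frequency vector. -/
noncomputable def empNormFreq {K N : ℕ} (ω : Fin N → Fin K → Bool) (i : Fin (K + 1)) : ℝ :=
  empFreq ω i / (K.choose i.val : ℝ)

/-- The triangular Pascal matrix taking the vector `x ^ j * (1 - x) ^ (K - j)`, `0 ≤ j ≤ K`,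
to the vector `x ^ i`, `0 ≤ i ≤ K`. -/
def pascalMatrix (K : ℕ) : Matrix (Fin (K + 1)) (Fin (K + 1)) ℝ :=
  Matrix.of fun i j => if i ≤ j then ((K - i.val).choose (j.val - i.val) : ℝ) else 0

/-- The empirical moment vector. -/
noncomputable def empMoment {K N : ℕ} (ω : Fin N → Fin K → Bool) : Fin (K + 1) → ℝ :=
  pascalMatrix K *ᵥ empNormFreq ω

/-- The point `j / m` of the grid `{0, 1/m, 2/m, …, 1}`. -/
noncomputable def gridPoint (m : ℕ) (j : Fin (m + 1)) : I :=
  ⟨(j.val : ℝ) / m, by positivity,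
    div_le_one_of_le₀ (by exact_mod_cast Nat.lt_succ_iff.mp j.isLt) (by positivity)⟩

/-- `x` is a feasible solution of the linear program for the guessed support `S` (a set of grid
points of the grid of width `1/m`), with tolerance `η` in the moment constraints. -/
def LPFeasible {K N : ℕ} (ω : Fin N → Fin K → Bool) (m : ℕ) (η : ℝ)
    (S : Finset (Fin (m + 1))) (x : Fin (m + 1) → ℝ) : Prop :=
  (∀ i : Fin (K + 1), 1 ≤ i.val →
    |∑ j ∈ S, x j * (gridPoint m j : ℝ) ^ i.val - empMoment ω i| ≤ η) ∧
  ∑ j ∈ S, x j = 1 ∧ ∀ j ∈ S, 0 ≤ x j ∧ x j ≤ 1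

/-- The discrete measure with mass `x j` at the grid point `j / m`, for `j ∈ S`. -/
noncomputable def gridMeasure (m : ℕ) (S : Finset (Fin (m + 1))) (x : Fin (m + 1) → ℝ) :
    Measure I :=
  ∑ j ∈ S, ENNReal.ofReal (x j) • Measure.dirac (gridPoint m j)

/-- `ϑ'` is a possible output, on the samples `ω`, of the algorithm with grid width `1/m` and
tolerance `η`: it comes from some feasible solution of the linear program for some guess of a
support consisting of `k` grid points. -/
def IsOutput {K N : ℕ} (k m : ℕ) (η : ℝ) (ω : Fin N → Fin K → Bool) (ϑ' : Measure I) : Prop :=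
  ∃ (S : Finset (Fin (m + 1))) (x : Fin (m + 1) → ℝ),
    S.card = k ∧ LPFeasible ω m η S x ∧ ϑ' = gridMeasure m S x

/-- The number `1/τ` of steps of the grid: `τ` is `(ε/k)^(ck) / c`, rounded down to the
reciprocal of an integer. -/
noncomputable def gridSize (c k : ℕ) (ε : ℝ) : ℕ :=
  ⌈(c : ℝ) * ((k : ℝ) / ε) ^ (c * k)⌉₊

/-! Two `k`-spike mixtures live on at most `2k` common points, so polynomials of degree below `2k`
can separate those points, and integrals of such polynomials are combinations of the moments of
order below `2k`. At a point followed by a gap of length `g` in the joint support, the indicator of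
the points to its left agrees there with a polynomial whose coefficients have absolute sum at most
`(4/g)^(2k)`. Moments within `η` therefore give distribution functions within `η (4/g)^(2k)` there
(`abs_cdf_sub_le_of_moments`).

Gaps shorter than `g` cost little: under the quantile coupling, a displacement above `2kg` must
cross a long gap, which happens only where the two distribution functions disagree
(`transportDist_le_of_gaps`).

Each empirical moment is an average of independent unbiased `[0,1]`-valued statistics, so
Hoeffding's inequality and a union bound put them all within `Kτ` of the truth. On that event the
mixture rounded to the grid is feasible (`exists_lpFeasible`), and every output has moments within
`3Kτ` of the true ones (`transportDist_output_le`). -/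

/-! ### Separating polynomials and distribution functions. -/

theorem sum_abs_coeff_X_mul_le {q : Polynomial ℝ} {B : ℝ}
    (hq : ∀ N, ∑ i ∈ Finset.range N, |q.coeff i| ≤ B) (N : ℕ) :
    ∑ i ∈ Finset.range N, |(Polynomial.X * q).coeff i| ≤ B := by
  cases N with
  | zero => simpa using hq 0
  | succ N =>
    rw [Finset.sum_range_succ']
    simpa using hq N

/-- A polynomial of small degree and small coefficients that separates two finite sets of points
of `[0,1]`, all points of the one lying at distance at least `g` to the left of those of the
other. -/
theorem exists_separating_polynomial {g : ℝ} (hg : 0 < g) (hg1 : g ≤ 1) (n : ℕ) :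
    ∀ U V : Finset ℝ, U.card + V.card = n → (∀ u ∈ U, 0 ≤ u ∧ u ≤ 1) → (∀ v ∈ V, 0 ≤ v ∧ v ≤ 1) →
      (∀ u ∈ U, ∀ v ∈ V, g ≤ v - u) →
      ∃ p : Polynomial ℝ, p.natDegree ≤ n - 1 ∧ (∀ u ∈ U, p.eval u = 1) ∧
        (∀ v ∈ V, p.eval v = 0) ∧ ∀ N, ∑ i ∈ Finset.range N, |p.coeff i| ≤ (4 / g) ^ n := by
  have h4 : 1 ≤ 4 / g := by rw [le_div_iff₀ hg]; linarith
  induction n with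
  | zero =>
    intro U V hn _ _ _
    have hU : U = ∅ := Finset.card_eq_zero.1 (by omega)
    have hV : V = ∅ := Finset.card_eq_zero.1 (by omega)
    exact ⟨0, by simp, by simp [hU], by simp, by simp⟩
  | succ n ih =>
    intro U V hn hU hV hUV
    rcases U.eq_empty_or_nonempty with rfl | ⟨u, hu⟩
    · exact ⟨0, by simp, by simp, by simp, fun N => by simpa using by positivity⟩
    rcases V.eq_empty_or_nonempty with rfl | ⟨v, hv⟩
    · refine ⟨1, by simp, by simp, by simp, fun N => ?_⟩
      refine le_trans ?_ (one_le_pow₀ h4)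
      simp only [Polynomial.coeff_one, apply_ite abs, abs_one, abs_zero, Finset.sum_ite_eq']
      split_ifs <;> norm_num
    have hvu := hUV u hu v hv
    have hne : v - u ≠ 0 := by linarith
    have cU := Finset.card_erase_of_mem hu
    have cV := Finset.card_erase_of_mem hv
    have pU := Finset.card_pos.2 ⟨u, hu⟩
    have pV := Finset.card_pos.2 ⟨v, hv⟩
    obtain ⟨q, hqd, hqU, hqV, hqB⟩ := ih (U.erase u) V (by omega)
      (fun x hx => hU x (Finset.mem_of_mem_erase hx)) hV
      (fun x hx => hUV x (Finset.mem_of_mem_erase hx))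
    obtain ⟨r, hrd, hrU, hrV, hrB⟩ := ih U (V.erase v) (by omega) hU
      (fun x hx => hV x (Finset.mem_of_mem_erase hx))
      (fun x hx y hy => hUV x hx y (Finset.mem_of_mem_erase hy))
    -- Aitken–Neville interpolation: the two weights sum to 1 after division by `v - u`, and each
    -- vanishes at the one point its factor does not control.
    refine ⟨Polynomial.C (v - u)⁻¹ * ((Polynomial.X - Polynomial.C u) * q +
      (Polynomial.C v - Polynomial.X) * r), ?_, ?_, ?_, fun N => ?_⟩
    · refine (Polynomial.natDegree_C_mul_le _ _).trans (Polynomial.natDegree_add_le_of_degree_le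
        (Polynomial.natDegree_mul_le.trans ?_) (Polynomial.natDegree_mul_le.trans ?_))
      · rw [Polynomial.natDegree_X_sub_C]; omega
      · rw [← Polynomial.natDegree_neg, neg_sub, Polynomial.natDegree_X_sub_C]; omega
    · intro x hx
      simp only [Polynomial.eval_mul, Polynomial.eval_C, Polynomial.eval_add, Polynomial.eval_sub,
        Polynomial.eval_X, hrU x hx]
      by_cases hxu : x = u
      · subst hxu; field_simp; ring
      · rw [hqU x (Finset.mem_erase.2 ⟨hxu, hx⟩)]; field_simp; ring
    · intro x hx
      simp only [Polynomial.eval_mul, Polynomial.eval_C, Polynomial.eval_add, Polynomial.eval_sub,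
        Polynomial.eval_X, hqV x hx]
      by_cases hxv : x = v
      · subst hxv; simp
      · rw [hrV x (Finset.mem_erase.2 ⟨hxv, hx⟩)]; simp
    · have hu1 := hU u hu
      have hv1 := hV v hv
      have hinv : (v - u)⁻¹ ≤ g⁻¹ := inv_anti₀ hg hvu
      -- The factor `4/g` per point: `q` and `r` are each multiplied by a linear polynomial with
      -- coefficient sum at most 2, and the quotient by `v - u` costs `1/g`.
      have key : ∀ i, |(Polynomial.C (v - u)⁻¹ * ((Polynomial.X - Polynomial.C u) * q +
          (Polynomial.C v - Polynomial.X) * r)).coeff i| ≤ g⁻¹ * (|(Polynomial.X * q).coeff i| +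
            |q.coeff i| + |r.coeff i| + |(Polynomial.X * r).coeff i|) := by
        intro i
        rw [Polynomial.coeff_C_mul, abs_mul, abs_of_pos (inv_pos.2 (by linarith : 0 < v - u))]
        refine mul_le_mul hinv ?_ (abs_nonneg _) (by positivity)
        simp only [sub_mul, Polynomial.coeff_add, Polynomial.coeff_sub, Polynomial.coeff_C_mul]
        have h1 : |u * q.coeff i| ≤ |q.coeff i| := by
          rw [abs_mul, abs_of_nonneg hu1.1]
          exact mul_le_of_le_one_left (abs_nonneg _) hu1.2
        have h2 : |v * r.coeff i| ≤ |r.coeff i| := by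
          rw [abs_mul, abs_of_nonneg hv1.1]
          exact mul_le_of_le_one_left (abs_nonneg _) hv1.2
        refine (abs_add_le _ _).trans ?_
        have h3 := abs_sub ((Polynomial.X * q).coeff i) (u * q.coeff i)
        have h4 := abs_sub (v * r.coeff i) ((Polynomial.X * r).coeff i)
        linarith
      refine (Finset.sum_le_sum fun i _ => key i).trans ?_
      rw [← Finset.mul_sum, Finset.sum_add_distrib, Finset.sum_add_distrib,
        Finset.sum_add_distrib, pow_succ, div_eq_mul_inv]
      have h1 := sum_abs_coeff_X_mul_le hqB N
      have h2 := sum_abs_coeff_X_mul_le hrB N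
      have h3 := hqB N
      have h5 := hrB N
      rw [div_eq_mul_inv] at h1 h2 h3 h5
      have : 0 ≤ g⁻¹ := by positivity
      nlinarith

theorem integral_polynomial_eval (P : Measure I) [IsProbabilityMeasure P] {p : Polynomial ℝ}
    {n : ℕ} (hp : p.natDegree < n) :
    ∫ x : I, p.eval (x : ℝ) ∂P = ∑ i ∈ Finset.range n, p.coeff i * ∫ x : I, (x : ℝ) ^ i ∂P := by
  simp_rw [Polynomial.eval_eq_sum_range' hp]
  rw [integral_finsetSum]
  · simp_rw [integral_const_mul]
  · intro i _
    exact Continuous.integrable_of_hasCompactSupport (by fun_prop)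
      (HasCompactSupport.of_compactSpace _)

/-- If two discrete distributions have close moments, their distribution functions are close at
every point followed by a long gap in the supports. -/
theorem abs_cdf_sub_le_of_moments {P Q : Measure I} [IsProbabilityMeasure P]
    [IsProbabilityMeasure Q] {S : Finset I} {n : ℕ} (hn : 0 < n) (hS : S.card ≤ n)
    (hP : P ((S : Set I)ᶜ) = 0) (hQ : Q ((S : Set I)ᶜ) = 0) {η g : ℝ} (hg : 0 < g) (hg1 : g ≤ 1)
    (hmom : ∀ i < n, |∫ x : I, (x : ℝ) ^ i ∂P - ∫ x : I, (x : ℝ) ^ i ∂Q| ≤ η) {a : I}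
    (ha : ∀ s ∈ S, s ≤ a ∨ (a : ℝ) + g ≤ s) :
    |P.real (Set.Iic a) - Q.real (Set.Iic a)| ≤ η * (4 / g) ^ n := by
  classical
  have hη : 0 ≤ η := (abs_nonneg _).trans (hmom 0 hn)
  have h4 : 1 ≤ 4 / g := by rw [le_div_iff₀ hg]; linarith
  set U : Finset ℝ := (S.filter (· ≤ a)).image (↑)
  set V : Finset ℝ := (S.filter (¬ · ≤ a)).image (↑)
  have hc : U.card + V.card ≤ n := by
    refine (Nat.add_le_add Finset.card_image_le Finset.card_image_le).trans ?_
    rwa [Finset.card_filter_add_card_filter_not]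
  obtain ⟨p, hd, hU, hV, hB⟩ := exists_separating_polynomial hg hg1 _ U V rfl
    (by simp only [U, Finset.mem_image]; rintro _ ⟨x, _, rfl⟩; exact x.2)
    (by simp only [V, Finset.mem_image]; rintro _ ⟨x, _, rfl⟩; exact x.2)
    (by
      simp only [U, V, Finset.mem_image, Finset.mem_filter]
      rintro _ ⟨x, ⟨_, hx⟩, rfl⟩ _ ⟨y, ⟨hyS, hy⟩, rfl⟩
      have h1 := (ha y hyS).resolve_left hy
      have h2 : (x : ℝ) ≤ a := hx
      linarith)
  -- On `S` the polynomial equals the indicator of `Set.Iic a`, so the distribution function at `a`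
  -- is a fixed combination of moments.
  have key : ∀ (M : Measure I) [IsProbabilityMeasure M], M ((S : Set I)ᶜ) = 0 →
      M.real (Set.Iic a) = ∑ i ∈ Finset.range n, p.coeff i * ∫ x : I, (x : ℝ) ^ i ∂M := by
    intro M _ hM
    rw [← integral_polynomial_eval M (by omega), ← integral_indicator_one measurableSet_Iic]
    refine integral_congr_ae ?_
    filter_upwards [compl_mem_ae_iff.2 hM] with x hx
    have hx : x ∈ S := by simpa using hx
    by_cases hxa : x ≤ a
    · rw [Set.indicator_of_mem (Set.mem_Iic.2 hxa), hU x (Finset.mem_image_of_mem _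
        (Finset.mem_filter.2 ⟨hx, hxa⟩))]
      rfl
    · rw [Set.indicator_of_notMem (by simpa using hxa), hV x (Finset.mem_image_of_mem _
        (Finset.mem_filter.2 ⟨hx, hxa⟩))]
  rw [key P hP, key Q hQ, ← Finset.sum_sub_distrib]
  calc |∑ i ∈ Finset.range n, (p.coeff i * ∫ x : I, (x : ℝ) ^ i ∂P -
        p.coeff i * ∫ x : I, (x : ℝ) ^ i ∂Q)|
      ≤ ∑ i ∈ Finset.range n, |p.coeff i| * η := by
        refine (Finset.abs_sum_le_sum_abs _ _).trans (Finset.sum_le_sum fun i hi => ?_)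
        rw [← mul_sub, abs_mul]
        exact mul_le_mul_of_nonneg_left (hmom i (Finset.mem_range.1 hi)) (abs_nonneg _)
    _ ≤ η * (4 / g) ^ n := by
        rw [← Finset.sum_mul, mul_comm]
        exact mul_le_mul_of_nonneg_left ((hB n).trans (pow_le_pow_right₀ h4 hc)) hη

/-! ### Long gaps and the quantile coupling. -/

/-- Two points of a finite set that are far apart are separated by a long gap of the set. -/
theorem exists_gap {g : ℝ} (S : Finset I) {x y : I} (hx : x ∈ S) (hy : y ∈ S)
    (hxy : (x : ℝ) + S.card * g < y) (hg : 0 < g) :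
    ∃ a ∈ S, x ≤ a ∧ (a : ℝ) + g ≤ y ∧ ∀ s ∈ S, s ≤ a ∨ (a : ℝ) + g ≤ s := by
  induction S using Finset.strongInduction generalizing x with
  | H S ih =>
    have hlt : x < y := by
      rw [← Subtype.coe_lt_coe]
      have : 0 ≤ (S.card : ℝ) * g := by positivity
      linarith
    set T := S.filter (x < ·)
    have hyT : y ∈ T := Finset.mem_filter.2 ⟨hy, hlt⟩
    obtain ⟨z, hzT, hz⟩ := T.exists_min_image id ⟨y, hyT⟩
    have hz : ∀ s ∈ T, (z : ℝ) ≤ s := hz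
    have hxz : x < z := (Finset.mem_filter.1 hzT).2
    by_cases h : (x : ℝ) + g ≤ z
    · refine ⟨x, hx, le_rfl, h.trans (hz y hyT), fun s hs => ?_⟩
      rcases le_or_gt s x with hsx | hsx
      · exact Or.inl hsx
      · exact Or.inr (h.trans (hz s (Finset.mem_filter.2 ⟨hs, hsx⟩)))
    · have hTS : T ⊂ S := Finset.filter_ssubset.2 ⟨x, hx, lt_irrefl x⟩
      have hc : (T.card : ℝ) + 1 ≤ S.card := by exact_mod_cast Finset.card_lt_card hTS
      obtain ⟨a, haT, hza, hay, ha⟩ := ih T hTS hzT hyT (by nlinarith)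
      refine ⟨a, hTS.1 haT, hxz.le.trans hza, hay, fun s hs => ?_⟩
      rcases le_or_gt s x with hsx | hsx
      · exact Or.inl (hsx.trans (hxz.le.trans hza))
      · exact ha s (Finset.mem_filter.2 ⟨hs, hsx⟩)

/-- The quantile function of a distribution on `[0,1]`. -/
noncomputable def quantile (P : Measure I) (u : I) : I :=
  sInf {x | (u : ℝ) ≤ P.real (Set.Iic x)}

/-- Right continuity of the distribution function makes the infimum attained. -/
theorem quantile_le_iff (P : Measure I) [IsProbabilityMeasure P] (u x : I) :
    quantile P u ≤ x ↔ (u : ℝ) ≤ P.real (Set.Iic x) := by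
  refine ⟨fun h => ?_, fun h => sInf_le h⟩
  have hmono : Monotone fun x : I => P.real (Set.Iic x) := fun x y hxy =>
    measureReal_mono (Set.Iic_subset_Iic.2 hxy)
  refine le_trans ?_ (hmono h)
  set A : Set I := {x | (u : ℝ) ≤ P.real (Set.Iic x)}
  have hA : A.Nonempty := by
    refine ⟨1, ?_⟩
    have : Set.Iic (1 : I) = Set.univ := Set.eq_univ_of_forall fun x => x.2.2
    simp only [A, Set.mem_ofPred_eq, this, probReal_univ]
    exact u.2.2
  have hcl : quantile P u ∈ closure A := csInf_mem_closure hA (OrderBot.bddBelow _)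
  have := mem_closure_iff_nhdsWithin_neBot.1 hcl
  have hcont : ContinuousWithinAt (fun x : I => P.real (Set.Iic x)) A (quantile P u) := by
    have hcdf : ∀ x : I, P.real (Set.Iic x) = cdf (P.map (↑)) (x : ℝ) := fun x => by
      rw [unitInterval.cdf_eq_real, ← Set.Icc_bot]
      rfl
    simp_rw [hcdf]
    have hr := (cdf (P.map (↑))).right_continuous ((quantile P u : I) : ℝ)
    have hmaps : Set.MapsTo (fun x : I => (x : ℝ)) A (Set.Ici ((quantile P u : I) : ℝ)) :=
      fun x hx => Subtype.coe_le_coe.2 (sInf_le hx)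
    exact ContinuousWithinAt.comp (f := fun x : I => (x : ℝ)) (x := quantile P u) hr
      continuous_subtype_val.continuousWithinAt hmaps
  exact ge_of_tendsto hcont self_mem_nhdsWithin

theorem measurable_quantile (P : Measure I) [IsProbabilityMeasure P] :
    Measurable (quantile P) := by
  refine measurable_of_Iic fun x => ?_
  have : quantile P ⁻¹' Set.Iic x = {u : I | (u : ℝ) ≤ P.real (Set.Iic x)} := by
    ext u; exact quantile_le_iff P u x
  rw [this]
  exact measurableSet_le measurable_subtype_coe measurable_const

theorem map_quantile (P : Measure I) [IsProbabilityMeasure P] :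
    (volume : Measure I).map (quantile P) = P := by
  have := Measure.isProbabilityMeasure_map (μ := (volume : Measure I))
    (measurable_quantile P).aemeasurable
  refine Measure.ext_of_Iic _ _ fun x => ?_
  rw [Measure.map_apply (measurable_quantile P) measurableSet_Iic]
  have : quantile P ⁻¹' Set.Iic x =
      Set.Iic (⟨P.real (Set.Iic x), measureReal_nonneg, measureReal_le_one⟩ : I) := by
    ext u; exact quantile_le_iff P u x
  rw [this, unitInterval.volume_Iic, ofReal_measureReal]

/-- The transportation distance of two distributions with finite support whose distribution
functions are close at all points followed by long gaps of the supports. -/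
theorem transportDist_le_of_gaps {P Q : Measure I} [IsProbabilityMeasure P]
    [IsProbabilityMeasure Q] {S : Finset I} (hP : P ((S : Set I)ᶜ) = 0)
    (hQ : Q ((S : Set I)ᶜ) = 0) {g D : ℝ} (hg : 0 < g) (hD : 0 ≤ D)
    (h : ∀ a ∈ S, (∀ s ∈ S, s ≤ a ∨ (a : ℝ) + g ≤ s) →
      |P.real (Set.Iic a) - Q.real (Set.Iic a)| ≤ D) :
    transportDist P Q ≤ ENNReal.ofReal (S.card * g + S.card * D) := by
  classical
  set X := quantile P
  set Y := quantile Q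
  have hX : Measurable X := measurable_quantile P
  have hY : Measurable Y := measurable_quantile Q
  have hXY : Measurable fun u => (X u, Y u) := hX.prodMk hY
  have hXS : ∀ᵐ u : I, X u ∈ S := by
    rw [← map_quantile P, Measure.map_apply hX S.measurableSet.compl] at hP
    filter_upwards [compl_mem_ae_iff.2 hP] with u hu
    simpa using hu
  have hYS : ∀ᵐ u : I, Y u ∈ S := by
    rw [← map_quantile Q, Measure.map_apply hY S.measurableSet.compl] at hQ
    filter_upwards [compl_mem_ae_iff.2 hQ] with u hu
    simpa using hu
  set T := S.filter fun a => ∀ s ∈ S, s ≤ a ∨ (a : ℝ) + g ≤ s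
  let p : I → I := fun a => ⟨P.real (Set.Iic a), measureReal_nonneg, measureReal_le_one⟩
  let q : I → I := fun a => ⟨Q.real (Set.Iic a), measureReal_nonneg, measureReal_le_one⟩
  let B : I → Set I := fun a => Set.uIoc (p a) (q a)
  have hB : ∀ a, MeasurableSet (B a) := fun a => measurableSet_uIoc
  -- Either the displacement is at most `S.card * g`, or it is bounded by 1, the diameter of `I`,
  -- and `u` lies between the two distribution functions at some long-gap point.
  have hpt : ∀ᵐ u : I, edist (X u) (Y u) ≤
      ENNReal.ofReal (S.card * g) + ∑ a ∈ T, (B a).indicator 1 u := by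
    filter_upwards [hXS, hYS] with u hXu hYu
    by_cases hu : |(X u : ℝ) - Y u| ≤ S.card * g
    · refine le_trans ?_ le_self_add
      rw [edist_dist, Subtype.dist_eq, Real.dist_eq]
      exact ENNReal.ofReal_le_ofReal hu
    · have h1 : edist (X u) (Y u) ≤ 1 := by
        rw [edist_dist, Subtype.dist_eq, Real.dist_eq, ← ENNReal.ofReal_one]
        refine ENNReal.ofReal_le_ofReal (abs_le.2 ⟨?_, ?_⟩) <;>
          linarith [(X u).2.1, (X u).2.2, (Y u).2.1, (Y u).2.2]
      obtain ⟨a, haT, haB⟩ : ∃ a ∈ T, u ∈ B a := by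
        rcases lt_max_iff.1 (not_le.1 hu) with hu | hu
        · obtain ⟨a, haS, h1, h2, h3⟩ := exists_gap (g := g) S hYu hXu (by linarith) hg
          refine ⟨a, Finset.mem_filter.2 ⟨haS, h3⟩, Set.mem_uIoc.2 (Or.inl ⟨?_, ?_⟩)⟩
          · rw [← not_le]
            intro hle
            have h4 : (X u : ℝ) ≤ a := (quantile_le_iff P u a).2 hle
            linarith
          · exact (quantile_le_iff Q u a).1 h1
        · obtain ⟨a, haS, h1, h2, h3⟩ := exists_gap (g := g) S hXu hYu (by linarith) hg
          refine ⟨a, Finset.mem_filter.2 ⟨haS, h3⟩, Set.mem_uIoc.2 (Or.inr ⟨?_, ?_⟩)⟩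
          · rw [← not_le]
            intro hle
            have h4 : (Y u : ℝ) ≤ a := (quantile_le_iff Q u a).2 hle
            linarith
          · exact (quantile_le_iff P u a).1 h1
      refine h1.trans (le_trans ?_ le_add_self)
      refine le_trans ?_ (Finset.single_le_sum (fun _ _ => zero_le) haT)
      simp [Set.indicator_of_mem haB]
  have hvol : ∀ a ∈ T, volume (B a) ≤ ENNReal.ofReal D := by
    intro a ha
    rw [Finset.mem_filter] at ha
    rw [unitInterval.volume_uIoc, edist_dist, Subtype.dist_eq, Real.dist_eq, abs_sub_comm]
    exact ENNReal.ofReal_le_ofReal (by simpa [p, q, abs_sub_comm] using h a ha.1 ha.2)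
  have hmap : (((volume : Measure I).map fun u => (X u, Y u)).map Prod.fst = P) ∧
      (((volume : Measure I).map fun u => (X u, Y u)).map Prod.snd = Q) := by
    rw [Measure.map_map measurable_fst hXY, Measure.map_map measurable_snd hXY]
    exact ⟨map_quantile P, map_quantile Q⟩
  refine (iInf₂_le ((volume : Measure I).map fun u => (X u, Y u)) hmap).trans ?_
  rw [lintegral_map (by fun_prop) hXY]
  refine (lintegral_mono_ae hpt).trans ?_
  rw [lintegral_add_left measurable_const, lintegral_const, measure_univ, mul_one,
    lintegral_finsetSum _ fun a _ => measurable_one.indicator (hB a),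
    ENNReal.ofReal_add (by positivity) (by positivity)]
  gcongr
  simp_rw [lintegral_indicator_one (hB _)]
  refine (Finset.sum_le_card_nsmul _ _ _ hvol).trans ?_
  rw [nsmul_eq_mul, ENNReal.ofReal_mul (by positivity), ENNReal.ofReal_natCast]
  gcongr
  exact Finset.filter_subset _ _

/-- Two `k`-spike mixtures with close moments are close in transportation distance. -/
theorem transportDist_le_of_moments {k : ℕ} (hk : 1 ≤ k) {P Q : Measure I}
    (hP : IsSpikeMixture k P) (hQ : IsSpikeMixture k Q) {η g : ℝ} (hg : 0 < g) (hg1 : g ≤ 1)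
    (hmom : ∀ i < 2 * k, |∫ x : I, (x : ℝ) ^ i ∂P - ∫ x : I, (x : ℝ) ^ i ∂Q| ≤ η) :
    transportDist P Q ≤ ENNReal.ofReal (2 * k * g + 2 * k * (η * (4 / g) ^ (2 * k))) := by
  classical
  obtain ⟨_, S, hSc, hS⟩ := hP
  obtain ⟨_, T, hTc, hT⟩ := hQ
  have hη : 0 ≤ η := (abs_nonneg _).trans (hmom 0 (by omega))
  have hc : (S ∪ T).card ≤ 2 * k := (Finset.card_union_le _ _).trans (by omega)
  have hS' : P (((S ∪ T : Finset I) : Set I)ᶜ) = 0 :=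
    measure_mono_null (Set.compl_subset_compl.2 (by simp)) hS
  have hT' : Q (((S ∪ T : Finset I) : Set I)ᶜ) = 0 :=
    measure_mono_null (Set.compl_subset_compl.2 (by simp)) hT
  refine (transportDist_le_of_gaps hS' hT' hg (by positivity) fun a _ ha =>
    abs_cdf_sub_le_of_moments (by omega) hc hS' hT' hg hg1 hmom ha).trans
    (ENNReal.ofReal_le_ofReal ?_)
  have hc' : ((S ∪ T).card : ℝ) ≤ 2 * k := by exact_mod_cast hc
  gcongr

/-! ### Discrete mixtures, rounding and feasibility. -/

theorem integral_eq_sum_of_support {ϑ : Measure I} [IsProbabilityMeasure ϑ] {T : Finset I}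
    (hT : ϑ ((T : Set I)ᶜ) = 0) (f : I → ℝ) : ∫ a, f a ∂ϑ = ∑ a ∈ T, ϑ.real {a} * f a := by
  have h : ϑ.restrict T = ϑ := Measure.restrict_eq_self_of_ae_mem (mem_ae_iff.2 hT)
  conv_lhs => rw [← h, setIntegral_finset T IntegrableOn.finset]
  simp

theorem isSpikeMixture_gridMeasure {k m : ℕ} {S : Finset (Fin (m + 1))} {x : Fin (m + 1) → ℝ}
    (hS : S.card = k) (h1 : ∑ j ∈ S, x j = 1) (h0 : ∀ j ∈ S, 0 ≤ x j) :
    IsSpikeMixture k (gridMeasure m S x) := by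
  classical
  refine ⟨⟨?_⟩, S.image (gridPoint m), hS ▸ Finset.card_image_le, ?_⟩
  · simp [gridMeasure, Measure.finsetSum_apply, ← ENNReal.ofReal_sum_of_nonneg h0, h1]
  · rw [gridMeasure, Measure.finsetSum_apply]
    refine Finset.sum_eq_zero fun j hj => ?_
    rw [Measure.smul_apply, Measure.dirac_apply' _ (Finset.measurableSet _).compl,
      Set.indicator_of_notMem, smul_zero]
    simpa using ⟨j, hj, rfl⟩

theorem integral_gridMeasure {m : ℕ} {S : Finset (Fin (m + 1))} {x : Fin (m + 1) → ℝ}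
    (h0 : ∀ j ∈ S, 0 ≤ x j) (f : I → ℝ) :
    ∫ a, f a ∂(gridMeasure m S x) = ∑ j ∈ S, x j * f (gridPoint m j) := by
  rw [gridMeasure, integral_finsetSum_measure]
  · refine Finset.sum_congr rfl fun j hj => ?_
    rw [integral_smul_measure, integral_dirac, ENNReal.toReal_ofReal (h0 j hj), smul_eq_mul]
  · intro j _
    exact (integrable_dirac (by simp)).smul_measure ENNReal.ofReal_ne_top

/-- The index of the grid point just below `a`. -/
noncomputable def gridFloor (m : ℕ) (a : I) : Fin (m + 1) :=
  ⟨⌊(a : ℝ) * m⌋₊, Nat.lt_succ_of_le (Nat.floor_le_of_le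
    (mul_le_of_le_one_left (Nat.cast_nonneg m) a.2.2))⟩

theorem abs_gridPoint_gridFloor_sub_le {m : ℕ} (hm : 0 < m) (a : I) :
    |(gridPoint m (gridFloor m a) : ℝ) - a| ≤ 1 / m := by
  have hm' : (0 : ℝ) < m := by exact_mod_cast hm
  have h1 := Nat.floor_le (mul_nonneg a.2.1 hm'.le)
  have h2 := Nat.lt_floor_add_one ((a : ℝ) * m)
  have h3 : (gridPoint m (gridFloor m a) : ℝ) - a = (⌊(a : ℝ) * m⌋₊ - a * m) / m := by
    simp only [gridPoint, gridFloor]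
    field_simp
  rw [h3, abs_div, abs_of_pos hm']
  gcongr
  rw [abs_le]
  constructor <;> linarith

theorem abs_pow_sub_pow_le_mul {x y : ℝ} (hx : 0 ≤ x) (hx1 : x ≤ 1) (hy : 0 ≤ y) (hy1 : y ≤ 1)
    (i : ℕ) : |x ^ i - y ^ i| ≤ i * |x - y| := by
  induction i with
  | zero => simp
  | succ i ih =>
    have h : x ^ (i + 1) - y ^ (i + 1) = x * (x ^ i - y ^ i) + (x - y) * y ^ i := by ring
    rw [h]
    refine (abs_add_le _ _).trans ?_
    rw [abs_mul, abs_mul, abs_of_nonneg hx, abs_of_nonneg (pow_nonneg hy i)]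
    have h1 : x * |x ^ i - y ^ i| ≤ |x ^ i - y ^ i| := mul_le_of_le_one_left (abs_nonneg _) hx1
    have h2 : |x - y| * y ^ i ≤ |x - y| :=
      mul_le_of_le_one_right (abs_nonneg _) (pow_le_one₀ hy hy1)
    push_cast
    linarith

/-- Rounding the spikes to the grid gives a feasible solution of the linear program whenever the
empirical moments are accurate. -/
theorem exists_lpFeasible {K N k m : ℕ} (hm : 0 < m) (hkm : k ≤ m + 1) {ϑ : Measure I}
    (hϑ : IsSpikeMixture k ϑ) {ω : Fin N → Fin K → Bool}
    (hω : ∀ i : Fin (K + 1), 1 ≤ i.val →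
      |empMoment ω i - ∫ a : I, (a : ℝ) ^ i.val ∂ϑ| ≤ K * (1 / m)) :
    ∃ (S : Finset (Fin (m + 1))) (x : Fin (m + 1) → ℝ), S.card = k ∧
      LPFeasible ω m (2 * K * (1 / m)) S x := by
  classical
  obtain ⟨_, T, hTk, hT⟩ := hϑ
  -- Spikes may be fewer than `k` or round to the same grid point; the support is padded to exactly
  -- `k` points, the extra ones receiving weight zero.
  obtain ⟨S, hTS, -, hS⟩ := Finset.exists_subsuperset_card_eq
    (Finset.subset_univ (T.image (gridFloor m))) (Finset.card_image_le.trans hTk)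
    (by simpa using hkm)
  have hmaps : ∀ a ∈ T, gridFloor m a ∈ S := fun a ha => hTS (Finset.mem_image_of_mem _ ha)
  have hsum : ∀ f : I → ℝ, ∑ j ∈ S, (∑ a ∈ T with gridFloor m a = j, ϑ.real {a}) *
      f (gridPoint m j) = ∫ a, f (gridPoint m (gridFloor m a)) ∂ϑ := by
    intro f
    rw [integral_eq_sum_of_support hT, ← Finset.sum_fiberwise_of_maps_to hmaps]
    refine Finset.sum_congr rfl fun j _ => ?_
    rw [Finset.sum_mul]
    refine Finset.sum_congr rfl fun a ha => ?_
    rw [(Finset.mem_filter.1 ha).2]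
  have h1 : ∑ j ∈ S, (∑ a ∈ T with gridFloor m a = j, ϑ.real {a}) = 1 := by
    simpa using hsum fun _ => 1
  have h0 : ∀ j ∈ S, 0 ≤ ∑ a ∈ T with gridFloor m a = j, ϑ.real {a} := fun j _ =>
    Finset.sum_nonneg fun _ _ => measureReal_nonneg
  refine ⟨S, fun j => ∑ a ∈ T with gridFloor m a = j, ϑ.real {a}, hS, ?_, h1, fun j hj =>
    ⟨h0 j hj, h1 ▸ Finset.single_le_sum h0 hj⟩⟩
  intro i hi
  rw [hsum fun a => (a : ℝ) ^ i.val]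
  -- Each power `i ≤ K` is `K`-Lipschitz on `[0,1]`, and rounding moves a spike by at most `1/m`.
  have hround : |∫ a, (gridPoint m (gridFloor m a) : ℝ) ^ i.val ∂ϑ -
      ∫ a : I, (a : ℝ) ^ i.val ∂ϑ| ≤ K * (1 / m) := by
    have hT1 : ∑ a ∈ T, ϑ.real {a} = 1 := by
      simpa using (integral_eq_sum_of_support hT fun _ => 1).symm
    rw [integral_eq_sum_of_support hT, integral_eq_sum_of_support hT, ← Finset.sum_sub_distrib]
    calc |∑ a ∈ T, (ϑ.real {a} * (gridPoint m (gridFloor m a) : ℝ) ^ i.val -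
          ϑ.real {a} * (a : ℝ) ^ i.val)|
        ≤ ∑ a ∈ T, ϑ.real {a} * (K * (1 / m)) := by
          refine (Finset.abs_sum_le_sum_abs _ _).trans (Finset.sum_le_sum fun a _ => ?_)
          rw [← mul_sub, abs_mul, abs_of_nonneg measureReal_nonneg]
          refine mul_le_mul_of_nonneg_left ?_ measureReal_nonneg
          refine (abs_pow_sub_pow_le_mul (gridPoint m _).2.1 (gridPoint m _).2.2 a.2.1 a.2.2 _).trans ?_
          have hiK : ((i.val : ℕ) : ℝ) ≤ K := by exact_mod_cast Nat.lt_succ_iff.1 i.isLt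
          exact mul_le_mul hiK (abs_gridPoint_gridFloor_sub_le hm a) (abs_nonneg _)
            (Nat.cast_nonneg _)
      _ = K * (1 / m) := by rw [← Finset.sum_mul, hT1, one_mul]
  have h2 := hω i hi
  rw [abs_sub_comm] at h2
  refine (abs_sub_le _ (∫ a : I, (a : ℝ) ^ i.val ∂ϑ) _).trans ?_
  linarith

/-! ### Unbiased moment estimates and their concentration. -/

/-- The contribution of a single snapshot to the `i`-th empirical moment. -/
noncomputable def momentStat {K : ℕ} (i : ℕ) (w : Fin K → Bool) : ℝ :=
  if i ≤ heads w then ((K - i).choose (heads w - i) : ℝ) / (K.choose (heads w) : ℝ) else 0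

theorem heads_le {K : ℕ} (w : Fin K → Bool) : heads w ≤ K := by
  simpa [heads] using Finset.card_filter_le (Finset.univ : Finset (Fin K)) fun t => w t = true

theorem momentStat_mem_Icc {K : ℕ} (i : ℕ) (w : Fin K → Bool) :
    momentStat i w ∈ Set.Icc (0 : ℝ) 1 := by
  unfold momentStat
  split_ifs with h
  · have hK := heads_le w
    refine ⟨by positivity, div_le_one_of_le₀ ?_ (by positivity)⟩
    have h1 : (K - i).choose (heads w - i) = (K - i).choose (K - heads w) := by
      rw [← Nat.choose_symm (by omega)]
      congr 1
      omega
    rw [h1, ← Nat.choose_symm hK]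
    exact_mod_cast Nat.choose_le_choose _ (Nat.sub_le K i)
  · simp

theorem empMoment_eq {K N : ℕ} (ω : Fin N → Fin K → Bool) (i : Fin (K + 1)) :
    empMoment ω i = (∑ s, momentStat i.val (ω s)) / N := by
  classical
  set c : Fin (K + 1) → ℝ := fun j =>
    pascalMatrix K i j / (K.choose j.val : ℝ) with hc
  have h1 : ∀ s, momentStat i.val (ω s) =
      ∑ j : Fin (K + 1), if heads (ω s) = j.val then c j else 0 := by
    intro s
    rw [Finset.sum_eq_single (⟨heads (ω s), Nat.lt_succ_of_le (heads_le _)⟩ : Fin (K + 1))]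
    · simp only [hc, if_true, pascalMatrix, Matrix.of_apply, momentStat, Fin.le_def]
      split_ifs <;> simp
    · intro j _ hj
      rw [if_neg]
      rintro h
      exact hj (Fin.ext h.symm)
    · simp
  simp_rw [h1]
  rw [Finset.sum_comm, Finset.sum_div, empMoment, Matrix.mulVec, dotProduct]
  refine Finset.sum_congr rfl fun j _ => ?_
  rw [Finset.sum_ite, Finset.sum_const_zero, add_zero, Finset.sum_const, nsmul_eq_mul]
  simp only [empNormFreq, empFreq, hc]
  ring

theorem tossLaw_real_singleton {K : ℕ} (α : I) (w : Fin K → Bool) :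
    (tossLaw K α).real {w} = (α : ℝ) ^ heads w * (1 - α) ^ (K - heads w) := by
  classical
  have h : ∀ b : Bool, (bernoulliMeasure true false α).real {b} =
      if b = true then (α : ℝ) else 1 - α := by
    intro b
    cases b <;> simp
  rw [measureReal_def, tossLaw, Measure.pi_singleton, ENNReal.toReal_prod]
  simp_rw [← measureReal_def, h]
  rw [Finset.prod_ite, Finset.prod_const, Finset.prod_const, heads]
  congr 2
  have := Finset.card_filter_add_card_filter_not (s := (Finset.univ : Finset (Fin K)))
    (fun t => w t = true)
  simp only [Finset.card_univ, Fintype.card_fin] at this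
  omega

theorem sum_heads {K : ℕ} (f : ℕ → ℝ) :
    ∑ w : Fin K → Bool, f (heads w) = ∑ j ∈ Finset.range (K + 1), (K.choose j : ℝ) * f j := by
  classical
  have h := Finset.sum_powerset_apply_card f (x := (Finset.univ : Finset (Fin K)))
  simp only [Finset.powerset_univ, Finset.card_univ, Fintype.card_fin, nsmul_eq_mul] at h
  rw [← h]
  refine Fintype.sum_bijective (fun w : Fin K → Bool => Finset.univ.filter fun t => w t = true)
    ⟨?_, ?_⟩ _ _ fun w => rfl
  · intro v w hvw
    funext t
    have := Finset.ext_iff.1 hvw t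
    simp only [Finset.mem_filter, Finset.mem_univ, true_and] at this
    exact Bool.eq_iff_iff.2 this
  · intro s
    exact ⟨fun t => decide (t ∈ s), by ext; simp⟩

/-- The statistic is the conditional probability, given the number of heads, that `i` prescribed
tosses are all heads. In the computation the factors `K.choose j` cancel and the binomial theorem
sums the rest. -/
theorem integral_momentStat_tossLaw {K i : ℕ} (hi : i ≤ K) (α : I) :
    ∫ w, momentStat i w ∂(tossLaw K α) = (α : ℝ) ^ i := by
  rw [integral_fintype Integrable.of_finite]
  simp_rw [tossLaw_real_singleton, smul_eq_mul, momentStat]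
  rw [sum_heads fun j => (α : ℝ) ^ j * (1 - α) ^ (K - j) *
    if i ≤ j then ((K - i).choose (j - i) : ℝ) / (K.choose j : ℝ) else 0]
  have hK : K + 1 = i + (K - i + 1) := by omega
  rw [hK, Finset.sum_range_add, Finset.sum_eq_zero, zero_add]
  · calc _ = ∑ j ∈ Finset.range (K - i + 1), (α : ℝ) ^ i *
          ((α : ℝ) ^ j * (1 - α) ^ (K - i - j) * ((K - i).choose j : ℝ)) := by
          refine Finset.sum_congr rfl fun j hj => ?_
          have hj : j ≤ K - i := Nat.lt_succ_iff.1 (Finset.mem_range.1 hj)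
          have hc : (K.choose (i + j) : ℝ) ≠ 0 := by
            exact_mod_cast (Nat.choose_pos (by omega : i + j ≤ K)).ne'
          rw [if_pos (Nat.le_add_right i j), Nat.add_sub_cancel_left, pow_add, Nat.sub_sub]
          field_simp
      _ = (α : ℝ) ^ i := by
          rw [← Finset.mul_sum, ← add_pow]
          simp
  · intro j hj
    rw [if_neg (by simpa using hj)]
    simp

theorem integral_momentStat {K i : ℕ} (hi : i ≤ K) (ϑ : Measure I) [IsProbabilityMeasure ϑ] :
    ∫ w, momentStat i w ∂(snapshotLaw K ϑ) = ∫ a : I, (a : ℝ) ^ i ∂ϑ := by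
  have hmeas : ∀ w, Measurable fun a => tossLaw K a {w} := fun w =>
    (Measure.measurable_coe (measurableSet_singleton w)).comp (measurable_tossLaw K)
  have hint : ∀ w, Integrable (fun a => (tossLaw K a).real {w} * momentStat i w) ϑ := fun w =>
    (Integrable.of_mem_Icc 0 1 (hmeas w).ennreal_toReal.aemeasurable
      (Filter.Eventually.of_forall fun _ => ⟨measureReal_nonneg, measureReal_le_one⟩)).mul_const _
  have hreal : ∀ w, (snapshotLaw K ϑ).real {w} = ∫ a, (tossLaw K a).real {w} ∂ϑ := fun w => by
    rw [measureReal_def, snapshotLaw, Measure.bind_apply (measurableSet_singleton w)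
      (measurable_tossLaw K).aemeasurable, ← integral_toReal (hmeas w).aemeasurable
      (Filter.Eventually.of_forall fun _ => measure_lt_top _ _)]
    rfl
  rw [integral_fintype Integrable.of_finite]
  simp_rw [← integral_momentStat_tossLaw hi, integral_fintype Integrable.of_finite, smul_eq_mul]
  rw [integral_finsetSum _ fun w _ => hint w]
  simp_rw [hreal, integral_mul_const]

/-- Hoeffding's inequality: a centred `[0,1]`-valued variable is sub-Gaussian with parameter 1/4,
and the two tails give the factor 2. -/
theorem measure_abs_sum_ge_le {Ω : Type*} [Finite Ω] [MeasurableSpace Ω]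
    [MeasurableSingletonClass Ω] (μ : Measure Ω) [IsProbabilityMeasure μ] {f : Ω → ℝ}
    (hf : ∀ w, f w ∈ Set.Icc (0 : ℝ) 1) {N : ℕ} (hN : 0 < N) {t : ℝ} (ht : 0 ≤ t) :
    (Measure.pi fun _ : Fin N => μ).real {ω | t ≤ |(∑ s, f (ω s)) / N - ∫ w, f w ∂μ|} ≤
      2 * Real.exp (-(2 * N * t ^ 2)) := by
  have hN' : (0 : ℝ) < N := by exact_mod_cast hN
  have one : ∀ g : Ω → ℝ, HasSubgaussianMGF g ((1 / 2) ^ 2) μ →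
      (Measure.pi fun _ : Fin N => μ).real {ω | N * t ≤ ∑ s, g (ω s)} ≤
        Real.exp (-(2 * N * t ^ 2)) := by
    intro g hg
    have hind : iIndepFun (fun (s : Fin N) (ω : Fin N → Ω) => g (ω s))
        (Measure.pi fun _ : Fin N => μ) :=
      iIndepFun_pi fun _ => (measurable_of_finite g).aemeasurable
    have h := HasSubgaussianMGF.measure_sum_ge_le_of_iIndepFun hind (s := Finset.univ)
      (c := fun _ => (1 / 2) ^ 2) (fun s _ => ?_) (mul_nonneg hN'.le ht)
    · refine h.trans (Real.exp_le_exp.2 (le_of_eq ?_))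
      simp only [Finset.sum_const, Finset.card_univ, Fintype.card_fin, nsmul_eq_mul]
      push_cast
      field_simp
    · refine HasSubgaussianMGF.of_map (X := g) (Y := fun ω : Fin N → Ω => ω s)
        (measurable_pi_apply s).aemeasurable ?_
      rw [(measurePreserving_eval (fun _ : Fin N => μ) s).map_eq]
      exact hg
  have hsub : HasSubgaussianMGF (fun w => f w - ∫ w, f w ∂μ) ((1 / 2) ^ 2) μ := by
    simpa using hasSubgaussianMGF_of_mem_Icc (μ := μ) (measurable_of_finite f).aemeasurable
      (Filter.Eventually.of_forall hf)
  have hpos := one _ hsub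
  have hneg := one _ hsub.neg
  have hsum : ∀ ω : Fin N → Ω, ∑ s, (f (ω s) - ∫ w, f w ∂μ) =
      N * ((∑ s, f (ω s)) / N - ∫ w, f w ∂μ) := by
    intro ω
    rw [Finset.sum_sub_distrib]
    simp only [Finset.sum_const, Finset.card_univ, Fintype.card_fin, nsmul_eq_mul]
    field_simp
  simp only [Pi.neg_apply, Finset.sum_neg_distrib, hsum] at hpos hneg
  refine (measureReal_mono ?_).trans ((measureReal_union_le _ _).trans
    ((add_le_add hpos hneg).trans (two_mul _).ge))
  intro ω hω
  rcases le_abs.1 (Set.mem_ofPred_eq ▸ hω) with h | h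
  · exact Or.inl (mul_le_mul_of_nonneg_left h hN'.le)
  · refine Or.inr ?_
    simp only [Set.mem_ofPred_eq]
    rw [← mul_neg]
    exact mul_le_mul_of_nonneg_left h hN'.le

/-- With high probability all empirical moments are accurate. -/
theorem measure_empMoment_ge {K N : ℕ} (ϑ : Measure I) [IsProbabilityMeasure ϑ] (hN : 0 < N)
    {t : ℝ} (ht : 0 ≤ t) :
    1 - K * (2 * Real.exp (-(2 * N * t ^ 2))) ≤
      (Measure.pi fun _ : Fin N => snapshotLaw K ϑ).real {ω | ∀ i : Fin (K + 1), 1 ≤ i.val →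
        |empMoment ω i - ∫ a : I, (a : ℝ) ^ i.val ∂ϑ| ≤ t} := by
  set μ := Measure.pi fun _ : Fin N => snapshotLaw K ϑ
  set G : Set (Fin N → Fin K → Bool) := {ω | ∀ i : Fin (K + 1), 1 ≤ i.val →
        |empMoment ω i - ∫ a : I, (a : ℝ) ^ i.val ∂ϑ| ≤ t}
  have hG : μ.real Gᶜ ≤ K * (2 * Real.exp (-(2 * N * t ^ 2))) := by
    -- Order 0 is not constrained, so the union bound runs over `K` events, with orders shifted by
    -- one.
    have hsub : Gᶜ ⊆ ⋃ i : Fin K, {ω | t ≤ |(∑ s, momentStat (i.val + 1) (ω s)) / N -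
        ∫ w, momentStat (i.val + 1) w ∂(snapshotLaw K ϑ)|} := by
      intro ω hω
      simp only [G, Set.mem_compl_iff, Set.mem_ofPred_eq, not_forall, not_le] at hω
      obtain ⟨i, hi, h⟩ := hω
      refine Set.mem_iUnion.2 ⟨⟨i.val - 1, by omega⟩, ?_⟩
      simp only [Set.mem_ofPred_eq, Nat.sub_add_cancel hi]
      rw [integral_momentStat (Nat.lt_succ_iff.1 i.isLt), ← empMoment_eq]
      exact h.le
    refine (measureReal_mono hsub).trans ((measureReal_iUnion_fintype_le _).trans ?_)
    refine (Finset.sum_le_card_nsmul _ _ _ fun i _ =>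
      measure_abs_sum_ge_le _ (momentStat_mem_Icc (i.val + 1)) hN ht).trans ?_
    simp
  have : μ.real Gᶜ = 1 - μ.real G := probReal_compl_eq_one_sub (Set.toFinite G).measurableSet
  linarith

/-! ### Arithmetic of the constants. -/

theorem natCast_le_div {k : ℕ} {ε : ℝ} (hε : 0 < ε) (hε1 : ε ≤ 1) : (k : ℝ) ≤ k / ε := by
  rw [le_div_iff₀ hε]
  exact mul_le_of_le_one_right (Nat.cast_nonneg k) hε1

theorem one_le_natCast_div {k : ℕ} {ε : ℝ} (hk : 1 ≤ k) (hε : 0 < ε) (hε1 : ε ≤ 1) :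
    1 ≤ (k : ℝ) / ε :=
  le_trans (by exact_mod_cast hk) (natCast_le_div hε hε1)

theorem le_gridSize {c k : ℕ} {ε : ℝ} :
    (c : ℝ) * ((k : ℝ) / ε) ^ (c * k) ≤ gridSize c k ε :=
  Nat.le_ceil _

theorem natCast_le_gridSize {c k : ℕ} {ε : ℝ} (hc : 1 ≤ c) (hk : 1 ≤ k) (hε : 0 < ε)
    (hε1 : ε ≤ 1) : k ≤ gridSize c k ε := by
  have hr := one_le_natCast_div hk hε hε1
  have hc' : (1 : ℝ) ≤ c := by exact_mod_cast hc
  have h1 : (k : ℝ) / ε ≤ ((k : ℝ) / ε) ^ (c * k) :=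
    le_self_pow₀ hr (Nat.mul_ne_zero (by omega) (by omega))
  have h2 : (k : ℝ) ≤ gridSize c k ε := by
    have h3 := natCast_le_div (k := k) hε hε1
    have h4 := le_gridSize (c := c) (k := k) (ε := ε)
    nlinarith
  exact_mod_cast h2

theorem gridSize_le {c k : ℕ} {ε : ℝ} (hc : 1 ≤ c) (hk : 1 ≤ k) (hε : 0 < ε)
    (hε1 : ε ≤ 1) : (gridSize c k ε : ℝ) ≤ 2 * c * ((k : ℝ) / ε) ^ (c * k) := by
  have hr := one_le_pow₀ (one_le_natCast_div hk hε hε1) (n := c * k)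
  have hc' : (1 : ℝ) ≤ c := by exact_mod_cast hc
  have h := Nat.ceil_lt_add_one (a := (c : ℝ) * ((k : ℝ) / ε) ^ (c * k)) (by positivity)
  rw [← gridSize] at h
  nlinarith

/-- Powers of `r` cannot absorb `256 ^ k` when `k = 1` and `r` is near 1; the constant factor
handles that case, while `k ≥ 2` forces `r ≥ 2`. -/
theorem pow_const_le {k : ℕ} {r : ℝ} (hr : 1 ≤ r) (hkr : (k : ℝ) ≤ r) (hk : 1 ≤ k) :
    (256 : ℝ) ^ k ≤ 256 * r ^ (8 * k) := by
  obtain rfl | hk2 := hk.eq_or_lt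
  · have := one_le_pow₀ hr (n := 8 * 1)
    linarith
  · have h2 : (2 : ℝ) ≤ r := le_trans (by exact_mod_cast hk2) hkr
    have h3 : (256 : ℝ) ^ k ≤ r ^ (8 * k) := by
      rw [pow_mul]
      refine pow_le_pow_left₀ (by norm_num) ?_ k
      calc (256 : ℝ) = 2 ^ 8 := by norm_num
        _ ≤ r ^ 8 := pow_le_pow_left₀ (by norm_num) h2 8
    have := one_le_pow₀ hr (n := 8 * k)
    linarith

/-- The bound on the transportation distance obtained from the tolerance of the linear program
is at most `ε`. -/
theorem transport_bound_le {c k : ℕ} {ε : ℝ} (hc : 6144 ≤ c) (hk : 1 ≤ k) (hε : 0 < ε)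
    (hε1 : ε ≤ 1) :
    2 * k * (ε / (4 * k)) + 2 * k * (3 * ((2 * k - 1 : ℕ) : ℝ) * (1 / (gridSize c k ε : ℝ)) *
      (4 / (ε / (4 * k))) ^ (2 * k)) ≤ ε := by
  have hk0 : (0 : ℝ) < k := by exact_mod_cast hk
  set r : ℝ := k / ε with hr_def
  have hr : 1 ≤ r := one_le_natCast_div hk hε hε1
  have hkr : (k : ℝ) ≤ r := natCast_le_div hε hε1
  have hkε : (k : ℝ) = r * ε := by rw [hr_def]; field_simp
  have hm : (c : ℝ) * r ^ (c * k) ≤ gridSize c k ε := le_gridSize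
  have hm0 : (0 : ℝ) < gridSize c k ε := by
    exact_mod_cast lt_of_lt_of_le hk (natCast_le_gridSize (by omega) hk hε hε1)
  have hc' : (6144 : ℝ) ≤ c := by exact_mod_cast hc
  have hK : ((2 * k - 1 : ℕ) : ℝ) ≤ 2 * k := by exact_mod_cast Nat.sub_le _ _
  have h16 : 4 / (ε / (4 * k)) = 16 * r := by rw [hr_def]; field_simp; norm_num
  have hg : 2 * k * (ε / (4 * k)) = ε / 2 := by field_simp; norm_num
  rw [h16, hg]
  have hpow : (16 * r) ^ (2 * k) ≤ 256 * r ^ (8 * k) * r ^ (2 * k) := by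
    rw [mul_pow, pow_mul (16 : ℝ)]
    norm_num only
    exact mul_le_mul_of_nonneg_right (pow_const_le hr hkr hk) (by positivity)
  have hexp : r * r * (r ^ (8 * k) * r ^ (2 * k)) ≤ r ^ (c * k) := by
    calc r * r * (r ^ (8 * k) * r ^ (2 * k)) = r ^ (2 + (8 * k + 2 * k)) := by ring
      _ ≤ r ^ (c * k) := pow_le_pow_right₀ hr (by nlinarith)
  -- The constant 6144 is `2 · (2 · 3 · 2 · 256)`, the outer 2 coming from the target `ε / 2`; the
  -- other half of `ε` is the short-gap term.
  have hmain : 2 * k * (3 * (2 * k) * (16 * r) ^ (2 * k)) ≤ ε / 2 * gridSize c k ε := by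
    calc 2 * k * (3 * (2 * k) * (16 * r) ^ (2 * k))
        ≤ 2 * k * (3 * (2 * k) * (256 * r ^ (8 * k) * r ^ (2 * k))) := by gcongr
      _ = 3072 * (k * k) * (r ^ (8 * k) * r ^ (2 * k)) := by ring
      _ ≤ 3072 * (r * ε * r) * (r ^ (8 * k) * r ^ (2 * k)) := by
          have : (k : ℝ) * k ≤ r * ε * r := by
            rw [← hkε]
            exact mul_le_mul_of_nonneg_left hkr hk0.le
          gcongr
      _ = ε / 2 * (6144 * (r * r * (r ^ (8 * k) * r ^ (2 * k)))) := by ring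
      _ ≤ ε / 2 * (c * r ^ (c * k)) := by gcongr
      _ ≤ ε / 2 * gridSize c k ε := by gcongr
  have hfin : 2 * k * (3 * ((2 * k - 1 : ℕ) : ℝ) * (1 / (gridSize c k ε : ℝ)) *
      (16 * r) ^ (2 * k)) ≤ ε / 2 := by
    calc _ ≤ 2 * k * (3 * (2 * k) * (1 / (gridSize c k ε : ℝ)) * (16 * r) ^ (2 * k)) := by gcongr
      _ = 2 * k * (3 * (2 * k) * (16 * r) ^ (2 * k)) / gridSize c k ε := by ring
      _ ≤ ε / 2 := by rwa [div_le_iff₀ hm0]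
  linarith

/-- The failure probability is at most `δ` for the stated number of samples. -/
theorem failure_bound_le {c k N : ℕ} {ε δ : ℝ} (hc : 1 ≤ c) (hk : 1 ≤ k) (hε : 0 < ε)
    (hε1 : ε ≤ 1) (hδ : 0 < δ) (hδ1 : δ ≤ 1 / 2)
    (hN : ((8 * c ^ 2 : ℕ) : ℝ) * ((k : ℝ) / ε) ^ (8 * c ^ 2 * k) * Real.log (1 / δ) ≤ N) :
    ((2 * k - 1 : ℕ) : ℝ) * (2 * Real.exp (-(2 * N *
      (((2 * k - 1 : ℕ) : ℝ) * (1 / (gridSize c k ε : ℝ))) ^ 2))) ≤ δ := by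
  have hr := one_le_natCast_div hk hε hε1
  have hm := gridSize_le hc hk hε hε1
  have hm0 : (0 : ℝ) < gridSize c k ε := by
    exact_mod_cast lt_of_lt_of_le hk (natCast_le_gridSize hc hk hε hε1)
  set r : ℝ := k / ε
  set K : ℝ := ((2 * k - 1 : ℕ) : ℝ)
  set m : ℝ := ((gridSize c k ε : ℕ) : ℝ)
  set L : ℝ := Real.log (1 / δ) with hL
  have hK : 1 ≤ K := by
    have : 1 ≤ 2 * k - 1 := by omega
    simpa [K] using (Nat.cast_le (α := ℝ)).2 this
  have hL2 : 2 / 3 ≤ L := by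
    have h1 : Real.log 2 ≤ L :=
      Real.log_le_log (by norm_num) (by rw [le_div_iff₀ hδ]; linarith)
    have h2 := Real.log_two_gt_d9
    linarith
  have hδL : δ = Real.exp (-L) := by
    rw [hL, one_div, Real.log_inv, neg_neg, Real.exp_log hδ]
  have hm2 : m ^ 2 ≤ 4 * c ^ 2 * r ^ (8 * c ^ 2 * k) := by
    calc m ^ 2 ≤ (2 * c * r ^ (c * k)) ^ 2 := pow_le_pow_left₀ hm0.le hm 2
      _ = 4 * c ^ 2 * r ^ (c * k * 2) := by rw [mul_pow, mul_pow, ← pow_mul]; norm_num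
      _ ≤ 4 * c ^ 2 * r ^ (8 * c ^ 2 * k) := by
          have h1 : c * k ≤ c ^ 2 * k := Nat.mul_le_mul_right k (Nat.le_self_pow two_ne_zero c)
          have h2 : c * k * 2 ≤ 8 * c ^ 2 * k := by
            rw [mul_assoc 8]
            omega
          exact mul_le_mul_of_nonneg_left (pow_le_pow_right₀ hr h2) (by positivity)
  -- The sample bound gives `N ≥ 2 L m²`, since `m² ≤ 4c² r^(8c²k)`; this is the source of `8c²`.
  have hexp : 4 * K ^ 2 * L ≤ 2 * N * (K * (1 / m)) ^ 2 := by
    have h1 : 2 * L * m ^ 2 ≤ N := by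
      refine le_trans ?_ hN
      push_cast
      nlinarith
    have h2 : 2 * (N : ℝ) * (K * (1 / m)) ^ 2 = 2 * K ^ 2 * N / m ^ 2 := by ring
    rw [h2, le_div_iff₀ (by positivity)]
    nlinarith [mul_le_mul_of_nonneg_left h1 (by positivity : 0 ≤ 2 * K ^ 2)]
  rw [hδL]
  -- The prefactor `2K` is absorbed as `exp (2K)`, which `3K²L` outweighs because `δ ≤ 1/2` keeps
  -- `L` above `2/3`.
  calc K * (2 * Real.exp (-(2 * N * (K * (1 / m)) ^ 2)))
      ≤ Real.exp (2 * K) * Real.exp (-(4 * K ^ 2 * L)) := by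
        have h1 := Real.add_one_le_exp (2 * K)
        have h2 : Real.exp (-(2 * N * (K * (1 / m)) ^ 2)) ≤ Real.exp (-(4 * K ^ 2 * L)) :=
          Real.exp_le_exp.2 (by linarith)
        rw [← mul_assoc, mul_comm K 2]
        exact mul_le_mul (by linarith) h2 (Real.exp_pos _).le (Real.exp_pos _).le
    _ ≤ Real.exp (-L) := by
        rw [← Real.exp_add]
        refine Real.exp_le_exp.2 ?_
        have h1 : 2 * K ≤ 3 * K ^ 2 * (2 / 3) := by nlinarith
        have h2 : 3 * K ^ 2 * (2 / 3) ≤ 3 * K ^ 2 * L := by gcongr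
        have h3 : L ≤ K ^ 2 * L := le_mul_of_one_le_left (by linarith) (one_le_pow₀ hK)
        linarith

/-! ### Correctness of the outputs and the final assembly. -/

/-- Every output of the algorithm is close to the true mixture when the empirical moments are
accurate. -/
theorem transportDist_output_le {c k N : ℕ} {ε : ℝ} (hc : 6144 ≤ c) (hk : 1 ≤ k) (hε : 0 < ε)
    (hε1 : ε ≤ 1) {ϑ ϑ' : Measure I} (hϑ : IsSpikeMixture k ϑ)
    {ω : Fin N → Fin (2 * k - 1) → Bool}
    (hω : ∀ i : Fin (2 * k - 1 + 1), 1 ≤ i.val →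
      |empMoment ω i - ∫ a : I, (a : ℝ) ^ i.val ∂ϑ| ≤
        ((2 * k - 1 : ℕ) : ℝ) * (1 / (gridSize c k ε : ℝ)))
    (hout : IsOutput k (gridSize c k ε)
      (2 * ((2 * k - 1 : ℕ) : ℝ) * (1 / (gridSize c k ε : ℝ))) ω ϑ') :
    transportDist ϑ' ϑ ≤ ENNReal.ofReal ε := by
  obtain ⟨S, x, hS, ⟨hmom, h1, h01⟩, rfl⟩ := hout
  have h0 : ∀ j ∈ S, 0 ≤ x j := fun j hj => (h01 j hj).1
  have hϑ' := isSpikeMixture_gridMeasure hS h1 h0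
  have := hϑ.1
  have := hϑ'.1
  have hk1 : (1 : ℝ) ≤ k := by exact_mod_cast hk
  -- The tolerance `2Kτ` and the sampling error `Kτ` add up to `η = 3Kτ`; this `g` makes the gap
  -- term `2kg` equal to `ε / 2`.
  refine (transportDist_le_of_moments hk hϑ' hϑ (g := ε / (4 * k)) (by positivity) ?_
    (η := 3 * ((2 * k - 1 : ℕ) : ℝ) * (1 / (gridSize c k ε : ℝ))) fun i hi => ?_).trans
    (ENNReal.ofReal_le_ofReal (transport_bound_le hc hk hε hε1))
  · rw [div_le_one (by positivity)]
    linarith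
  · rcases Nat.eq_zero_or_pos i with rfl | hi0
    -- The program has no constraint of order 0; both zeroth moments equal 1.
    · simp only [pow_zero, integral_const, probReal_univ, smul_eq_mul, mul_one, sub_self, abs_zero]
      positivity
    · rw [integral_gridMeasure h0 fun a => (a : ℝ) ^ i]
      have h2 := hmom ⟨i, by omega⟩ hi0
      have h3 := hω ⟨i, by omega⟩ hi0
      refine (abs_sub_le _ (empMoment ω ⟨i, by omega⟩) _).trans ?_
      simp only at h2 h3
      linarith

theorem mainTheorem6 :
    ∃ A c C : ℕ, 0 < A ∧ 0 < c ∧ 0 < C ∧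
      ∀ (k : ℕ) (ε δ : ℝ), 1 ≤ k → 0 < ε → ε ≤ 1 → 0 < δ → δ ≤ 1 / 2 →
      ∀ N : ℕ, (C : ℝ) * ((k : ℝ) / ε) ^ (C * k) * Real.log (1 / δ) ≤ (N : ℝ) →
      ∀ ϑ : Measure I, IsSpikeMixture k ϑ →
        ENNReal.ofReal (1 - δ) ≤
          Measure.pi (fun _ : Fin N => snapshotLaw (2 * k - 1) ϑ)
            {ω | (∃ ϑ' : Measure I,
                    IsOutput k (gridSize c k ε)
                      ((A : ℝ) * ((2 * k - 1 : ℕ) : ℝ) * (1 / (gridSize c k ε : ℝ))) ω ϑ') ∧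
                 ∀ ϑ' : Measure I,
                    IsOutput k (gridSize c k ε)
                      ((A : ℝ) * ((2 * k - 1 : ℕ) : ℝ) * (1 / (gridSize c k ε : ℝ))) ω ϑ' →
                    transportDist ϑ' ϑ ≤ ENNReal.ofReal ε} := by
  -- `A = 2` allows one `Kτ` for rounding and one for sampling; `c` comes from `transport_bound_le`
  -- and `C = 8c²` from `failure_bound_le`.
  refine ⟨2, 6144, 8 * 6144 ^ 2, by norm_num, by norm_num, by norm_num, ?_⟩
  intro k ε δ hk hε hε1 hδ hδ1 N hN ϑ hϑ
  generalize hc : (6144 : ℕ) = c at hN ⊢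
  have hc1 : 1 ≤ c := by omega
  have := hϑ.1
  have hr := one_le_natCast_div hk hε hε1
  have hN0 : 0 < N := by
    have hL : 0 < Real.log (1 / δ) :=
      Real.log_pos (by rw [lt_div_iff₀ hδ]; linarith)
    have : (0 : ℝ) < N := by
      refine lt_of_lt_of_le ?_ hN
      positivity
    exact_mod_cast this
  have hkm := natCast_le_gridSize hc1 hk hε hε1
  have hprob := measure_empMoment_ge (K := 2 * k - 1) ϑ hN0
    (t := ((2 * k - 1 : ℕ) : ℝ) * (1 / (gridSize c k ε : ℝ))) (by positivity)
  have hfail := failure_bound_le hc1 hk hε hε1 hδ hδ1 hN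
  rw [Nat.cast_ofNat]
  refine (ENNReal.ofReal_le_ofReal (le_trans (by linarith) hprob)).trans ?_
  rw [ofReal_measureReal]
  refine measure_mono fun ω hω => ⟨?_, fun ϑ' hout =>
    transportDist_output_le (by omega) hk hε hε1 hϑ hω hout⟩
  obtain ⟨S, x, hS, hx⟩ := exists_lpFeasible (by omega) (by omega) hϑ hω
  exact ⟨_, S, x, hS, hx, rfl⟩
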